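/- Let $\mathcal H$ and $\mathcal K$ be complex Hilbert spaces. Let $F\colon \mathcal H\to\mathcal K$ be a rigging operator, that is, a closed densely defined linear operator with trivial kernel and dense range. Let $\mathcal J$ be a real vector space of bounded self-adjoint operators on $\mathcal K$, put $$\mathcal A_0(F)=\{F^*JF : J\in\mathcal J\},$$ let $H_0$ be an operator on $\mathcal H$ with domain $\mathcal D$, and let $\mathcal A = H_0+\mathcal A_0(F)$. Assume that 1. every operator $H\in\mathcal A$ is self-adjoint; 2. $\mathcal D\subset \operatorname{dom}(F)$ and $\mathcal D\subset\operatorname{dom}(V)$ for every $V\in\mathcal A_0(F)$ (hence all $H\in\mathcal A$ have the common domain $\mathcal D$); 3. for every $H\in\mathcal A$ and every non-real $z$, the operator $F(H-z)^{-1}F^*$, defined on $\operatorname{dom}(F^*)$, is bounded and its continuous extension $T_z(H)$ to $\mathcal K$ is compact. For $H\in\mathcal A$ let $\Lambda(H,F)$ be the set of all $\lambda\in\mathbb R$ for which the limit $T_{\lambda+i0}(H)=\lim_{y\to0^+}T_{\lambda+iy}(H)$ exists in the operator norm, and let $\Lambda(\mathcal A,F)=\bigcup_{H\in\mathcal A}\Lambda(H,F)$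 be the set of essentially regular points. If $\lambda\in\mathbb R$ is an eigenvalue of infinite multiplicity of at least one operator $H\in\mathcal A$, then $\lambda$ is not essentially regular: $\lambda\notin\Lambda(\mathcal A,F)$. That is, the norm limit $T_{\lambda+i0}(H)$ fails to exist for every $H\in\mathcal A$. -/

import Mathlib

open Topology Filter
open scoped LinearPMap

noncomputable section

namespace SandwichedResolvent

variable {E G K : Type*}
  [NormedAddCommGroup E] [InnerProductSpace ℂ E]
  [NormedAddCommGroup G] [InnerProductSpace ℂ G]
  [NormedAddCommGroup K] [InnerProductSpace ℂ K]

/-- The product `B A` of two unbounded operators, on its natural domain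
`{x ∈ dom A | A x ∈ dom B}`. -/
def pcomp (B : G →ₗ.[ℂ] K) (A : E →ₗ.[ℂ] G) : E →ₗ.[ℂ] K where
  domain := (B.domain.comap A.toFun).map A.domain.subtype
  toFun :=
    { toFun := fun x => B ⟨A ⟨x, by
          obtain ⟨y, -, hy⟩ := x.2; rw [← hy]; exact y.2⟩, by
          obtain ⟨_, y, hyB, rfl⟩ := x; exact hyB⟩
      map_add' := fun x y => by
        rw [← B.map_add]; congr 1; ext; exact A.map_add ⟨_, _⟩ ⟨_, _⟩
      map_smul' := fun c x => by
        rw [RingHom.id_apply, ← B.map_smul]; congr 1; ext; exact A.map_smul c ⟨_, _⟩ }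

/-- The operator `H - z`, with domain `dom H`. -/
def shift (H : E →ₗ.[ℂ] E) (z : ℂ) : E →ₗ.[ℂ] E where
  domain := H.domain
  toFun := H.toFun - z • H.domain.subtype

/-- The resolvent `R_z(H) = (H - z)⁻¹`, defined on the range of `H - z` (which is the whole space
if `H` is self-adjoint and `z` is not real). -/
def resolventOp (H : E →ₗ.[ℂ] E) (z : ℂ) : E →ₗ.[ℂ] E :=
  (shift H z).inverse

/-- The eigenspace `{χ ∈ dom H | H χ = z χ}`. -/
def eigenspace (H : E →ₗ.[ℂ] E) (z : ℂ) : Submodule ℂ E :=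
  (LinearMap.ker (shift H z).toFun).map H.domain.subtype

/-- `A` is bounded on its domain and extends to a compact operator on the whole space. -/
def HasCompactExtension (A : E →ₗ.[ℂ] G) : Prop :=
  ∃ B : E →L[ℂ] G, IsCompactOperator B ∧ ∀ x : A.domain, B x = A x

open Classical in
/-- The continuous extension of a densely defined bounded operator to the whole space
(with value `0` if there is none). -/
def boundedExtension (A : E →ₗ.[ℂ] G) : E →L[ℂ] G :=
  if h : ∃ B : E →L[ℂ] G, ∀ x : A.domain, B x = A x then h.choose else 0

/-- A rigging operator: a closed densely defined operator with trivial kernel and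
trivial co-kernel (dense range). -/
structure IsRigging (F : E →ₗ.[ℂ] K) : Prop where
  closed : F.IsClosed
  dense_domain : Dense (F.domain : Set E)
  ker_eq_bot : LinearMap.ker F.toFun = ⊥
  dense_range : Dense (Set.range F)

variable [CompleteSpace E] [CompleteSpace K]

/-- The operator `F R_z(H) F*` on its natural domain. -/
def sandwichedPMap (F : E →ₗ.[ℂ] K) (H : E →ₗ.[ℂ] E) (z : ℂ) : K →ₗ.[ℂ] K :=
  pcomp F (pcomp (resolventOp H z) F†)

/-- The sandwiched resolvent `T_z(H)`, the continuous extension of `F R_z(H) F*` to `K`. -/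
def sandwichedResolvent (F : E →ₗ.[ℂ] K) (H : E →ₗ.[ℂ] E) (z : ℂ) : K →L[ℂ] K :=
  boundedExtension (sandwichedPMap F H z)

/-- The perturbation `V = F* J F` on its natural domain. -/
def perturbation (F : E →ₗ.[ℂ] K) (J : K →L[ℂ] K) : E →ₗ.[ℂ] E :=
  pcomp F† (pcomp ((J : K →ₗ[ℂ] K).toPMap ⊤) F)

/-- The family `𝒜₀(F)` of all `V = F* J F`, where `J` runs over a given real vector space `𝒥` of
bounded self-adjoint operators on `K`. -/
def perturbations (F : E →ₗ.[ℂ] K) (𝒥 : Submodule ℝ (selfAdjoint (K →L[ℂ] K))) :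
    Set (E →ₗ.[ℂ] E) :=
  {V | ∃ J ∈ 𝒥, V = perturbation F (J : K →L[ℂ] K)}

/-- The affine space `𝒜 = H₀ + 𝒜₀(F)`. -/
def affineSpace (H₀ : E →ₗ.[ℂ] E) (F : E →ₗ.[ℂ] K)
    (𝒥 : Submodule ℝ (selfAdjoint (K →L[ℂ] K))) : Set (E →ₗ.[ℂ] E) :=
  {H | ∃ V ∈ perturbations F 𝒥, H = H₀ + V}

/-- The standing assumptions on the affine space `𝒜 = H₀ + 𝒜₀(F)` and the rigging `F`. -/
structure IsCompatible (H₀ : E →ₗ.[ℂ] E) (F : E →ₗ.[ℂ] K)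
    (𝒥 : Submodule ℝ (selfAdjoint (K →L[ℂ] K))) : Prop where
  rigging : IsRigging F
  isSelfAdjoint : ∀ H ∈ affineSpace H₀ F 𝒥, IsSelfAdjoint H
  domain_le_perturbation : ∀ V ∈ perturbations F 𝒥, H₀.domain ≤ V.domain
  domain_le_rigging : H₀.domain ≤ F.domain
  compact : ∀ H ∈ affineSpace H₀ F 𝒥, ∀ z : ℂ, z.im ≠ 0 →
    HasCompactExtension (sandwichedPMap F H z)

/-- The set `Λ(H, F)` of all real `l` for which `T_{l + iy}(H)` has a limit in the operator norm
as `y → 0⁺`. -/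
def regularSet (H : E →ₗ.[ℂ] E) (F : E →ₗ.[ℂ] K) : Set ℝ :=
  {l | ∃ T : K →L[ℂ] K, Tendsto
    (fun y : ℝ => sandwichedResolvent F H ((l : ℂ) + (y : ℂ) * Complex.I)) (𝓝[>] 0) (𝓝 T)}

/-- The set `Λ(𝒜, F)` of essentially regular points. -/
def essentiallyRegularSet (H₀ : E →ₗ.[ℂ] E) (F : E →ₗ.[ℂ] K)
    (𝒥 : Submodule ℝ (selfAdjoint (K →L[ℂ] K))) : Set ℝ :=
  ⋃ H ∈ affineSpace H₀ F 𝒥, regularSet H F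

end SandwichedResolvent

end

namespace SandwichedResolvent

/-! ### Products, sums, resolvents and extensions through graphs -/

section Graphs

variable {E G K : Type*}
  [NormedAddCommGroup E] [InnerProductSpace ℂ E]
  [NormedAddCommGroup G] [InnerProductSpace ℂ G]
  [NormedAddCommGroup K] [InnerProductSpace ℂ K]

/-! Suppose `T_z(H₁) → T` in norm as `z = l + iy → l`, and `H₂ χ = l χ` for another `H₂` in the
family. With `j = (J₂ - J₁) F χ` this reads `(H₁ - l) χ = -F* j`, hence `F χ + T_z j = -iy F R_z χ`.
Paired with `k ∈ dom F*`, the right side is at most `y ‖u‖ ‖χ‖`, where `u = R_{conj z} F* k`. Since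
`y ‖u‖² = Im ⟨k, T_z k⟩ ≤ ‖T_z‖ ‖k‖²`, it is `O(√y)` and vanishes in the limit
(`norm_inner_add_sandwichedResolvent_sq_le`, `add_apply_eq_zero_of_tendsto`).

Thus `F χ = -T (J₂ - J₁) F χ`. As a norm limit of compact operators `T` is compact, so the
eigenspace of `T (J₂ - J₁)` at `-1` is finite dimensional, and the injective `F` embeds the
eigenspace of `H₂` into it. -/

theorem mem_graph_pcomp {B : G →ₗ.[ℂ] K} {A : E →ₗ.[ℂ] G} {x : E} {w : K} :
    (x, w) ∈ (pcomp B A).graph ↔ ∃ y, (x, y) ∈ A.graph ∧ (y, w) ∈ B.graph := by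
  constructor
  · intro h
    obtain ⟨⟨x, a, haB, rfl⟩, rfl, rfl⟩ := (LinearPMap.mem_graph_iff _).1 h
    exact ⟨A a, A.mem_graph a, B.mem_graph ⟨A a, haB⟩⟩
  · rintro ⟨y, hA, hB⟩
    obtain ⟨a, rfl, rfl⟩ := (LinearPMap.mem_graph_iff _).1 hA
    obtain ⟨b, hb, rfl⟩ := (LinearPMap.mem_graph_iff _).1 hB
    refine (LinearPMap.mem_graph_iff _).2 ⟨⟨a, a, ?_, rfl⟩, rfl, ?_⟩
    · change A a ∈ B.domain
      rw [← show (b : G) = A a from hb]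
      exact b.2
    · exact congrArg B (Subtype.ext hb.symm)

theorem mem_graph_add {A B : E →ₗ.[ℂ] G} {x : E} {w : G} :
    (x, w) ∈ (A + B).graph ↔ ∃ a b, (x, a) ∈ A.graph ∧ (x, b) ∈ B.graph ∧ a + b = w := by
  constructor
  · intro h
    obtain ⟨x, rfl, rfl⟩ := (LinearPMap.mem_graph_iff _).1 h
    exact ⟨_, _, A.mem_graph ⟨x, x.2.1⟩, B.mem_graph ⟨x, x.2.2⟩, rfl⟩
  · rintro ⟨a, b, hA, hB, rfl⟩
    obtain ⟨x, rfl, rfl⟩ := (LinearPMap.mem_graph_iff _).1 hA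
    obtain ⟨y, hy, rfl⟩ := (LinearPMap.mem_graph_iff _).1 hB
    have hxB : (x : E) ∈ B.domain := by
      rw [← show (y : E) = x from hy]
      exact y.2
    obtain rfl : y = ⟨x, hxB⟩ := Subtype.ext hy
    exact (LinearPMap.mem_graph_iff _).2 ⟨⟨x, x.2, hxB⟩, rfl, rfl⟩

theorem mem_eigenspace {H : E →ₗ.[ℂ] E} {z : ℂ} {x : E} :
    x ∈ eigenspace H z ↔ (x, z • x) ∈ H.graph := by
  constructor
  · rintro ⟨a, ha, rfl⟩
    exact (LinearPMap.mem_graph_iff _).2 ⟨a, rfl, sub_eq_zero.1 ha⟩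
  · intro h
    obtain ⟨a, rfl, ha⟩ := (LinearPMap.mem_graph_iff _).1 h
    exact ⟨a, sub_eq_zero.2 ha, rfl⟩

theorem mem_graph_resolventOp {H : E →ₗ.[ℂ] E} {z : ℂ} (hker : eigenspace H z = ⊥) {x w : E}
    (h : (x, w + z • x) ∈ H.graph) : (w, x) ∈ (resolventOp H z).graph := by
  obtain ⟨a, rfl, ha⟩ := (LinearPMap.mem_graph_iff _).1 h
  have hker' : (shift H z).toFun.ker = ⊥ :=
    (Submodule.map_injective_of_injective H.domain.subtype_injective).eq_iff'
      (Submodule.map_bot _) |>.1 hker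
  have := LinearPMap.mem_inverse_graph hker' a
  have hw : shift H z a = w := sub_eq_iff_eq_add.2 ha
  rwa [hw] at this

theorem boundedExtension_apply {A : E →ₗ.[ℂ] G} (hA : HasCompactExtension A) {x : E} {w : G}
    (h : (x, w) ∈ A.graph) : boundedExtension A x = w := by
  have hex : ∃ B : E →L[ℂ] G, ∀ x : A.domain, B x = A x := hA.imp fun _ h => h.2
  obtain ⟨a, rfl, rfl⟩ := (LinearPMap.mem_graph_iff _).1 h
  rw [boundedExtension, dif_pos hex]
  exact hex.choose_spec a

/-- Density makes the extension unique, so the chosen one is the compact one. -/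
theorem isCompactOperator_boundedExtension {A : E →ₗ.[ℂ] G} (hA : HasCompactExtension A)
    (hd : Dense (A.domain : Set E)) : IsCompactOperator (boundedExtension A) := by
  obtain ⟨B, hB, hBA⟩ := id hA
  have : ⇑(boundedExtension A) = B :=
    (boundedExtension A).continuous.ext_on hd B.continuous fun x hx =>
      (boundedExtension_apply hA (A.mem_graph ⟨x, hx⟩)).trans (hBA ⟨x, hx⟩).symm
  rwa [this]

end Graphs

/-! ### Adjoint of a closed operator -/

section Adjoint

variable {E K : Type*}
  [NormedAddCommGroup E] [InnerProductSpace ℂ E] [CompleteSpace E]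
  [NormedAddCommGroup K] [InnerProductSpace ℂ K]

theorem inner_eq_of_mem_graph_adjoint {F : E →ₗ.[ℂ] K} (hd : Dense (F.domain : Set E))
    {k f : K} {w x : E} (hk : (k, w) ∈ F†.graph) (hx : (x, f) ∈ F.graph) :
    inner ℂ w x = inner ℂ k f := by
  obtain ⟨k, rfl, rfl⟩ := (LinearPMap.mem_graph_iff _).1 hk
  obtain ⟨x, rfl, rfl⟩ := (LinearPMap.mem_graph_iff _).1 hx
  exact LinearPMap.adjoint_isFormalAdjoint hd k x

/-- The adjoint of a closed operator is densely defined. -/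
theorem dense_adjoint_domain [CompleteSpace K] {F : E →ₗ.[ℂ] K} (hc : F.IsClosed) :
    Dense (F†.domain : Set K) := by
  rw [Submodule.dense_iff_topologicalClosure_eq_top, Submodule.topologicalClosure_eq_top_iff,
    Submodule.eq_bot_iff]
  intro v hv
  -- The `L²` product norm makes `E × K` a Hilbert space, so the closed graph `Γ` equals `Γᗮᗮ`.
  -- Elements of `Γᗮ` are the pairs `(-F* k, k)`, so `v ⟂ dom F*` puts `(0, v)` in `Γᗮᗮ`.
  let Γ : Submodule ℂ (WithLp 2 (E × K)) :=
    F.graph.comap (WithLp.linearEquiv 2 ℂ (E × K)).toLinearMap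
  have hΓ : IsClosed (Γ : Set (WithLp 2 (E × K))) :=
    IsClosed.preimage (WithLp.prod_continuous_ofLp 2 E K) hc
  have : CompleteSpace Γ := hΓ.completeSpace_coe
  have hmem : WithLp.toLp 2 ((0 : E), v) ∈ Γᗮᗮ := by
    rw [Submodule.mem_orthogonal]
    intro u hu
    have hdom : u.snd ∈ F†.domain := by
      refine LinearPMap.mem_adjoint_domain_of_exists _ ⟨-u.fst, fun x => ?_⟩
      have h := (Submodule.mem_orthogonal' _ _).1 hu (WithLp.toLp 2 ((x : E), F x))
        (F.mem_graph x)
      rw [WithLp.prod_inner_apply] at h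
      rw [inner_neg_left]
      exact neg_eq_of_add_eq_zero_right h
    rw [WithLp.prod_inner_apply]
    simpa using (Submodule.mem_orthogonal _ _).1 hv _ hdom
  rw [Submodule.orthogonal_orthogonal] at hmem
  exact F.graph_fst_eq_zero_snd (x := 0) (x' := v) hmem rfl

end Adjoint

/-! ### Resolvents of self-adjoint operators -/

section SelfAdjoint

variable {E : Type*} [NormedAddCommGroup E] [InnerProductSpace ℂ E] [CompleteSpace E]
  {A : E →ₗ.[ℂ] E}

theorem inner_eq_of_isSelfAdjoint (hA : IsSelfAdjoint A) {x x' y y' : E}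
    (hx : (x, x') ∈ A.graph) (hy : (y, y') ∈ A.graph) : inner ℂ x' y = inner ℂ x y' := by
  refine inner_eq_of_mem_graph_adjoint hA.dense_domain ?_ hy
  rwa [LinearPMap.isSelfAdjoint_def.1 hA]

/-- The adjoint relation between the resolvents at `z` and at `conj z`. -/
theorem inner_resolvent_eq (hA : IsSelfAdjoint A) {z : ℂ} {u v w p : E}
    (hu : (u, w + (starRingEnd ℂ) z • u) ∈ A.graph) (hv : (v, p + z • v) ∈ A.graph) :
    inner ℂ u p = inner ℂ w v := by
  have h := inner_eq_of_isSelfAdjoint hA hu hv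
  rw [inner_add_left, inner_add_right, inner_smul_left, inner_smul_right, Complex.conj_conj] at h
  exact (add_right_cancel h).symm

/-- Here `w = (A - z) x`, and `⟨x, A x⟩` is real by symmetry. -/
theorem im_inner_resolvent (hA : IsSelfAdjoint A) {z : ℂ} {x w : E}
    (h : (x, w + z • x) ∈ A.graph) : (inner ℂ x w).im = -z.im * ‖x‖ ^ 2 := by
  have h1 := inner_eq_of_isSelfAdjoint hA h h
  have h2 : (inner ℂ x (w + z • x) : ℂ).im = 0 := by
    rw [← Complex.conj_eq_iff_im, inner_conj_symm]
    exact h1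
  rw [inner_add_right, inner_smul_right, inner_self_eq_norm_sq_to_K, Complex.add_im] at h2
  have h3 : (z * (‖x‖ : ℂ) ^ 2).im = z.im * ‖x‖ ^ 2 := by
    rw [← Complex.ofReal_pow, Complex.im_mul_ofReal]
  have h4 := congrArg ((inner ℂ x w : ℂ).im + ·) h3
  replace h2 := h4.symm.trans h2
  linarith

theorem norm_le_of_isSelfAdjoint (hA : IsSelfAdjoint A) {z : ℂ} {x w : E}
    (h : (x, w + z • x) ∈ A.graph) : |z.im| * ‖x‖ ≤ ‖w‖ := by
  rcases (norm_nonneg x).eq_or_lt with hx | hx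
  · rw [← hx, mul_zero]
    exact norm_nonneg w
  · have h1 : |z.im| * ‖x‖ ^ 2 ≤ ‖x‖ * ‖w‖ := by
      have := (Complex.abs_im_le_norm (inner ℂ x w)).trans (norm_inner_le_norm x w)
      rwa [im_inner_resolvent hA h, abs_mul, abs_neg, abs_of_nonneg (sq_nonneg ‖x‖)] at this
    refine le_of_mul_le_mul_left ?_ hx
    linarith

theorem eigenspace_eq_bot_of_isSelfAdjoint (hA : IsSelfAdjoint A) {z : ℂ} (hz : z.im ≠ 0) :
    eigenspace A z = ⊥ := by
  refine (Submodule.eq_bot_iff _).2 fun x hx => ?_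
  have h : (x, (0 : E) + z • x) ∈ A.graph := by
    rw [zero_add]
    exact mem_eigenspace.1 hx
  have h1 := norm_le_of_isSelfAdjoint hA h
  rw [norm_zero] at h1
  exact norm_le_zero_iff.1 (nonpos_of_mul_nonpos_right h1 (abs_pos.2 hz))

/-- For self-adjoint `A` and non-real `z` the operator `A - z` is surjective. -/
theorem exists_resolvent_of_isSelfAdjoint (hA : IsSelfAdjoint A) {z : ℂ} (hz : z.im ≠ 0) (w : E) :
    ∃ x, (x, w + z • x) ∈ A.graph := by
  let Φ : A.graph →L[ℂ] E :=
    ((ContinuousLinearMap.snd ℂ E E) - z • (ContinuousLinearMap.fst ℂ E E)).comp A.graph.subtypeL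
  have hΦ : ∀ q : A.graph, (q.1.1, Φ q + z • q.1.1) ∈ A.graph := fun q => by
    have : Φ q + z • q.1.1 = q.1.2 := sub_add_cancel _ _
    rw [this]
    exact q.2
  have hpos : 0 < |z.im| := abs_pos.2 hz
  have hcomplete : CompleteSpace A.graph := (show IsClosed (A.graph : Set (E × E)) from hA.isClosed).completeSpace_coe
  -- `Φ` is `A - z` on the complete graph; it is bounded below because `‖x‖ ≤ ‖w‖ / |Im z|` and `‖A
  -- x‖ ≤ ‖w‖ + ‖z‖ ‖x‖`.
  have hclosed : IsClosed (Set.range Φ) := by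
    have hanti : AntilipschitzWith (Real.toNNReal (1 + (1 + ‖z‖) / |z.im|)) Φ := by
      refine Φ.antilipschitz_of_bound fun q => ?_
      rw [Real.coe_toNNReal _ (by positivity)]
      have h1 : ‖q.1.1‖ ≤ ‖Φ q‖ / |z.im| := by
        rw [le_div_iff₀ hpos, mul_comm]
        exact norm_le_of_isSelfAdjoint hA (hΦ q)
      have h2 : ‖q.1.2‖ ≤ ‖Φ q‖ + ‖z‖ * ‖q.1.1‖ := by
        rw [← norm_smul]
        refine le_trans (le_of_eq ?_) (norm_add_le _ _)
        exact congrArg norm (sub_add_cancel _ _).symm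
      have h3 : ‖z‖ * ‖q.1.1‖ ≤ ‖z‖ * (‖Φ q‖ / |z.im|) := by gcongr
      have h4 : 0 ≤ ‖Φ q‖ / |z.im| := by positivity
      have h5 : 0 ≤ ‖z‖ * (‖Φ q‖ / |z.im|) := by positivity
      have h6 : (1 + (1 + ‖z‖) / |z.im|) * ‖Φ q‖
          = ‖Φ q‖ + ‖Φ q‖ / |z.im| + ‖z‖ * (‖Φ q‖ / |z.im|) := by ring
      rw [h6]
      refine max_le (h1.trans ?_) (h2.trans ?_)
      · linarith [norm_nonneg (Φ q)]
      · linarith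
    exact hanti.isClosed_range Φ.uniformContinuous
  -- A vector orthogonal to the range is an eigenvector of `A† = A` at the non-real point `conj z`,
  -- hence zero.
  have hbot : (LinearMap.range Φ.toLinearMap)ᗮ = ⊥ := by
    refine (Submodule.eq_bot_iff _).2 fun u hu => ?_
    have horth : ∀ x : A.domain, inner ℂ ((starRingEnd ℂ) z • u) (x : E) = inner ℂ u (A x) := by
      intro x
      have h := (Submodule.mem_orthogonal' _ _).1 hu (A x - z • (x : E))
        ⟨⟨_, A.mem_graph x⟩, rfl⟩
      rw [inner_sub_right, inner_smul_right, sub_eq_zero] at h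
      rw [inner_smul_left, Complex.conj_conj, h]
    have hdom := LinearPMap.mem_adjoint_domain_of_exists u ⟨_, horth⟩
    have hval := LinearPMap.adjoint_apply_eq hA.dense_domain ⟨u, hdom⟩ horth
    have hgraph : (u, (starRingEnd ℂ) z • u) ∈ A.graph := by
      have : (u, (starRingEnd ℂ) z • u) ∈ A†.graph :=
        (LinearPMap.mem_graph_iff _).2 ⟨⟨u, hdom⟩, rfl, hval⟩
      rwa [LinearPMap.isSelfAdjoint_def.1 hA] at this
    have hmem := mem_eigenspace.2 hgraph
    rw [eigenspace_eq_bot_of_isSelfAdjoint hA (by simpa using hz)] at hmem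
    exact hmem
  have htop : LinearMap.range Φ.toLinearMap = ⊤ := by
    rw [← Submodule.topologicalClosure_eq_top_iff] at hbot
    rwa [IsClosed.submodule_topologicalClosure_eq hclosed] at hbot
  obtain ⟨q, rfl⟩ : ∃ q, Φ q = w := LinearMap.range_eq_top.1 htop w
  exact ⟨_, hΦ q⟩

end SelfAdjoint

/-! ### Sandwiched resolvents at non-real points -/

section Perturbation

variable {E K : Type*}
  [NormedAddCommGroup E] [InnerProductSpace ℂ E] [CompleteSpace E]
  [NormedAddCommGroup K] [InnerProductSpace ℂ K]
  {F : E →ₗ.[ℂ] K} {H : E →ₗ.[ℂ] E}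

theorem mem_graph_perturbation {J : K →L[ℂ] K} {x v : E} :
    (x, v) ∈ (perturbation F J).graph ↔ ∃ f, (x, f) ∈ F.graph ∧ (J f, v) ∈ F†.graph := by
  rw [perturbation, mem_graph_pcomp]
  constructor
  · rintro ⟨k, hk, hv⟩
    obtain ⟨f, hf, hJ⟩ := mem_graph_pcomp.1 hk
    obtain ⟨g, rfl, rfl⟩ := (LinearPMap.mem_graph_iff _).1 hJ
    exact ⟨g, hf, hv⟩
  · rintro ⟨f, hf, hv⟩
    exact ⟨J f, mem_graph_pcomp.2
      ⟨f, hf, (LinearPMap.mem_graph_iff _).2 ⟨⟨f, trivial⟩, rfl, rfl⟩⟩, hv⟩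

theorem mem_graph_sandwichedPMap (hH : IsSelfAdjoint H) {z : ℂ} (hz : z.im ≠ 0) {k f : K}
    {w x : E} (hk : (k, w) ∈ F†.graph) (hx : (x, w + z • x) ∈ H.graph) (hf : (x, f) ∈ F.graph) :
    (k, f) ∈ (sandwichedPMap F H z).graph :=
  mem_graph_pcomp.2 ⟨x, mem_graph_pcomp.2
    ⟨w, hk, mem_graph_resolventOp (eigenspace_eq_bot_of_isSelfAdjoint hH hz) hx⟩, hf⟩

theorem adjoint_domain_le_sandwichedPMap_domain (hH : IsSelfAdjoint H)
    (hHF : H.domain ≤ F.domain) {z : ℂ} (hz : z.im ≠ 0) :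
    F†.domain ≤ (sandwichedPMap F H z).domain := by
  intro k hk
  obtain ⟨x, hx⟩ := exists_resolvent_of_isSelfAdjoint hH hz (F† ⟨k, hk⟩)
  have hxF : x ∈ F.domain := hHF (LinearPMap.mem_domain_of_mem_graph hx)
  exact LinearPMap.mem_domain_of_mem_graph
    (mem_graph_sandwichedPMap hH hz (F†.mem_graph ⟨k, hk⟩) hx (F.mem_graph ⟨x, hxF⟩))

theorem inner_sandwichedResolvent (hd : Dense (F.domain : Set E)) (hH : IsSelfAdjoint H)
    (hHF : H.domain ≤ F.domain) {z : ℂ} (hz : z.im ≠ 0)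
    (hT : HasCompactExtension (sandwichedPMap F H z)) {k j : K} {w p u : E}
    (hk : (k, w) ∈ F†.graph) (hj : (j, p) ∈ F†.graph)
    (hu : (u, w + (starRingEnd ℂ) z • u) ∈ H.graph) :
    inner ℂ k (sandwichedResolvent F H z j) = inner ℂ u p := by
  obtain ⟨v, hv⟩ := exists_resolvent_of_isSelfAdjoint hH hz p
  have hvF := F.mem_graph ⟨v, hHF (LinearPMap.mem_domain_of_mem_graph hv)⟩
  rw [sandwichedResolvent, boundedExtension_apply hT (mem_graph_sandwichedPMap hH hz hj hv hvF),
    inner_resolvent_eq hH hu hv, inner_eq_of_mem_graph_adjoint hd hk hvF]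

/-- The vector `F R_z χ` need not be bounded as `y → 0`. Testing against `k ∈ dom F*` moves the
resolvent onto `F* k`, whose image has norm `O(y^(-1/2))` when `‖T_z‖` is bounded; the prefactor `y`
beats this. -/
theorem norm_inner_add_sandwichedResolvent_sq_le (hd : Dense (F.domain : Set E))
    (hH : IsSelfAdjoint H) (hHF : H.domain ≤ F.domain) {l y : ℝ} (hy : 0 < y)
    (hT : HasCompactExtension (sandwichedPMap F H ((l : ℂ) + (y : ℂ) * Complex.I)))
    {k j f : K} {p χ : E} (hk : k ∈ F†.domain) (hj : (j, p) ∈ F†.graph)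
    (hf : (χ, f) ∈ F.graph) (hχ : (χ, (l : ℂ) • χ - p) ∈ H.graph) :
    ‖(inner ℂ k (f + sandwichedResolvent F H ((l : ℂ) + (y : ℂ) * Complex.I) j) : ℂ)‖ ^ 2 ≤
      y * ‖sandwichedResolvent F H ((l : ℂ) + (y : ℂ) * Complex.I)‖ * (‖k‖ ^ 2 * ‖χ‖ ^ 2) := by
  set z : ℂ := (l : ℂ) + (y : ℂ) * Complex.I with hzdef
  have hzim : z.im = y := by simp [hzdef]
  have hz : z.im ≠ 0 := hzim ▸ hy.ne'
  have hz' : ((starRingEnd ℂ) z).im = -y := by rw [Complex.conj_im, hzim]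
  set T := sandwichedResolvent F H z
  set w := F† ⟨k, hk⟩
  have hkw : (k, w) ∈ F†.graph := F†.mem_graph ⟨k, hk⟩
  obtain ⟨u, hu⟩ := exists_resolvent_of_isSelfAdjoint hH (z := (starRingEnd ℂ) z)
    (by rw [hz']; exact neg_ne_zero.2 hy.ne') w
  have hu_norm : y * ‖u‖ ^ 2 ≤ ‖T‖ * ‖k‖ ^ 2 := by
    have h1 := im_inner_resolvent hH hu
    rw [hz', neg_neg, ← inner_sandwichedResolvent hd hH hHF hz hT hkw hkw hu] at h1
    rw [← h1]
    calc _ ≤ ‖(inner ℂ k (T k) : ℂ)‖ := (le_abs_self _).trans (Complex.abs_im_le_norm _)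
      _ ≤ ‖k‖ * ‖T k‖ := norm_inner_le_norm _ _
      _ ≤ ‖k‖ * (‖T‖ * ‖k‖) := by gcongr; exact T.le_opNorm k
      _ = ‖T‖ * ‖k‖ ^ 2 := by ring
  -- Shifting from `l` to `z` turns `(H - l) χ = -p` into `(H - z) χ = -p - iy χ`.
  have hχ' : (χ, (-p - ((y : ℂ) * Complex.I) • χ) + z • χ) ∈ H.graph := by
    have : (-p - ((y : ℂ) * Complex.I) • χ) + z • χ = (l : ℂ) • χ - p := by
      rw [hzdef, add_smul]
      abel
    rwa [this]
  have hid : (inner ℂ k (f + T j) : ℂ) = -((y : ℂ) * Complex.I) * inner ℂ u χ := by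
    have h1 := inner_resolvent_eq hH hu hχ'
    rw [inner_eq_of_mem_graph_adjoint hd hkw hf, inner_sub_right, inner_neg_right,
      inner_smul_right] at h1
    rw [inner_add_right, inner_sandwichedResolvent hd hH hHF hz hT hkw hj hu, ← h1]
    ring
  have hnorm : ‖(inner ℂ k (f + T j) : ℂ)‖ ≤ y * (‖u‖ * ‖χ‖) := by
    rw [hid, norm_mul, norm_neg, norm_mul, Complex.norm_I, mul_one, Complex.norm_real,
      Real.norm_of_nonneg hy.le]
    gcongr
    exact norm_inner_le_norm _ _
  -- One of the two factors `y` is absorbed by `‖u‖²`; the other survives.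
  calc _ ≤ (y * (‖u‖ * ‖χ‖)) ^ 2 := by gcongr
    _ = y * (y * ‖u‖ ^ 2) * ‖χ‖ ^ 2 := by ring
    _ ≤ y * (‖T‖ * ‖k‖ ^ 2) * ‖χ‖ ^ 2 := by gcongr
    _ = _ := by ring

end Perturbation

/-! ### Boundary values and finite multiplicity -/

section Sandwiched

variable {E K : Type*}
  [NormedAddCommGroup E] [InnerProductSpace ℂ E] [CompleteSpace E]
  [NormedAddCommGroup K] [InnerProductSpace ℂ K] [CompleteSpace K]
  {F : E →ₗ.[ℂ] K} {H : E →ₗ.[ℂ] E}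

/-- If `(H - l) χ = - F* j` and `T_{l + iy}(H) → T`, then `F χ = - T j`. -/
theorem add_apply_eq_zero_of_tendsto (hF : IsRigging F)
    (hH : IsSelfAdjoint H) (hHF : H.domain ≤ F.domain)
    (hT : ∀ z : ℂ, z.im ≠ 0 → HasCompactExtension (sandwichedPMap F H z)) {l : ℝ}
    {T : K →L[ℂ] K} (hlim : Tendsto
      (fun y : ℝ => sandwichedResolvent F H ((l : ℂ) + (y : ℂ) * Complex.I)) (𝓝[>] 0) (𝓝 T))
    {j f : K} {p χ : E} (hj : (j, p) ∈ F†.graph) (hf : (χ, f) ∈ F.graph)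
    (hχ : (χ, (l : ℂ) • χ - p) ∈ H.graph) : f + T j = 0 := by
  refine (dense_adjoint_domain hF.closed).eq_zero_of_inner_right ℂ fun k hk => ?_
  have h1 : Tendsto (fun y : ℝ => ‖(inner ℂ k
      (f + sandwichedResolvent F H ((l : ℂ) + (y : ℂ) * Complex.I) j) : ℂ)‖ ^ 2) (𝓝[>] 0)
      (𝓝 (‖(inner ℂ k (f + T j) : ℂ)‖ ^ 2)) :=
    (((tendsto_const_nhds (x := k)).inner
      (((ContinuousLinearMap.apply ℂ K j).continuous.tendsto T).comp hlim |>.const_add f)).norm).pow 2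
  have h2 : Tendsto (fun y : ℝ => y *
      ‖sandwichedResolvent F H ((l : ℂ) + (y : ℂ) * Complex.I)‖ * (‖k‖ ^ 2 * ‖χ‖ ^ 2)) (𝓝[>] 0)
      (𝓝 (0 * ‖T‖ * (‖k‖ ^ 2 * ‖χ‖ ^ 2))) :=
    ((tendsto_nhdsWithin_of_tendsto_nhds tendsto_id).mul hlim.norm).mul_const _
  have h3 := le_of_tendsto_of_tendsto h1 h2 <| by
    filter_upwards [self_mem_nhdsWithin] with y hy
    refine norm_inner_add_sandwichedResolvent_sq_le hF.dense_domain hH hHF hy (hT _ ?_) hk hj hf hχ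
    simpa using (ne_of_gt hy : y ≠ 0)
  rw [zero_mul, zero_mul] at h3
  exact norm_eq_zero.1 (pow_eq_zero_iff two_ne_zero |>.1 (le_antisymm h3 (sq_nonneg _)))

theorem isCompactOperator_of_tendsto_sandwichedResolvent (hF : IsRigging F)
    (hH : IsSelfAdjoint H) (hHF : H.domain ≤ F.domain)
    (hT : ∀ z : ℂ, z.im ≠ 0 → HasCompactExtension (sandwichedPMap F H z)) {l : ℝ}
    {T : K →L[ℂ] K} (hlim : Tendsto
      (fun y : ℝ => sandwichedResolvent F H ((l : ℂ) + (y : ℂ) * Complex.I)) (𝓝[>] 0) (𝓝 T)) :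
    IsCompactOperator T := by
  refine isCompactOperator_of_tendsto hlim ?_
  filter_upwards [self_mem_nhdsWithin] with y hy
  have hz : ((l : ℂ) + (y : ℂ) * Complex.I).im ≠ 0 := by simpa using (ne_of_gt hy : y ≠ 0)
  exact isCompactOperator_boundedExtension (hT _ hz)
    ((dense_adjoint_domain hF.closed).mono
      (adjoint_domain_le_sandwichedPMap_domain hH hHF hz))

/-- If `T_{l + i0}(H₁)` exists for some `H₁` in the affine space, then the eigenspace at `l` of
every `H₂` in the affine space is finite dimensional: `F` embeds it in the kernel of
`1 + T_{l + i0}(H₁) (J₂ - J₁)`. -/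
theorem finiteDimensional_eigenspace_of_mem_regularSet {H₀ : E →ₗ.[ℂ] E}
    {𝒥 : Submodule ℝ (selfAdjoint (K →L[ℂ] K))} (hcomp : IsCompatible H₀ F 𝒥)
    {H₁ H₂ : E →ₗ.[ℂ] E} (h₁ : H₁ ∈ affineSpace H₀ F 𝒥) (h₂ : H₂ ∈ affineSpace H₀ F 𝒥)
    {l : ℝ} (hl : l ∈ regularSet H₁ F) : FiniteDimensional ℂ (eigenspace H₂ (l : ℂ)) := by
  have hsa := hcomp.isSelfAdjoint H₁ h₁
  have hcpt := hcomp.compact H₁ h₁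
  obtain ⟨T, hlim⟩ := hl
  obtain ⟨V₁, hV₁, rfl⟩ := h₁
  obtain ⟨V₂, ⟨J₂, -, rfl⟩, rfl⟩ := h₂
  have hdomV := hcomp.domain_le_perturbation _ hV₁
  obtain ⟨J₁, -, rfl⟩ := hV₁
  set S : K →L[ℂ] K := T.comp ((J₂ : K →L[ℂ] K) - (J₁ : K →L[ℂ] K))
  have hHF : (H₀ + perturbation F (J₁ : K →L[ℂ] K)).domain ≤ F.domain :=
    inf_le_left.trans hcomp.domain_le_rigging
  have hScpt : IsCompactOperator S :=
    (isCompactOperator_of_tendsto_sandwichedResolvent hcomp.rigging hsa hHF hcpt hlim).comp_clm _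
  have hle : eigenspace (H₀ + perturbation F (J₂ : K →L[ℂ] K)) (l : ℂ) ≤ F.domain := fun x hx =>
    hcomp.domain_le_rigging (LinearPMap.mem_domain_of_mem_graph (mem_eigenspace.1 hx)).1
  have hmap : ∀ x, F.toFun.comp (Submodule.inclusion hle) x ∈
      Module.End.eigenspace (S : K →ₗ[ℂ] K) (-1) := by
    intro x
    have hxF : ((x : E), F (Submodule.inclusion hle x)) ∈ F.graph :=
      F.mem_graph (Submodule.inclusion hle x)
    obtain ⟨a, v₂, ha, hv₂, hav⟩ := mem_graph_add.1 (mem_eigenspace.1 x.2)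
    obtain ⟨v₁, hv₁⟩ := LinearPMap.mem_domain_iff.1
      (hdomV (LinearPMap.mem_domain_of_mem_graph ha))
    obtain ⟨f, hf, hJ₁⟩ := mem_graph_perturbation.1 hv₁
    obtain rfl := F.mem_graph_snd_inj hf hxF rfl
    obtain ⟨f', hf', hJ₂⟩ := mem_graph_perturbation.1 hv₂
    obtain rfl := F.mem_graph_snd_inj hf' hxF rfl
    -- With `a = H₀ x` and `vᵢ = F* Jᵢ F x`, replacing `v₂` by `v₁` in `a + v₂ = l x` gives `H₁ x =
    -- l x - (v₂ - v₁)`.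
    have hχ : ((x : E), (l : ℂ) • (x : E) - (v₂ - v₁)) ∈
        (H₀ + perturbation F (J₁ : K →L[ℂ] K)).graph :=
      mem_graph_add.2 ⟨a, v₁, ha, hv₁, by rw [← hav]; abel⟩
    have key := add_apply_eq_zero_of_tendsto hcomp.rigging hsa hHF hcpt hlim
      (F†.graph.sub_mem hJ₂ hJ₁) hxF hχ
    rw [Module.End.mem_eigenspace_iff, neg_one_smul]
    exact (neg_eq_of_add_eq_zero_right key).symm
  have := ContinuousLinearMap.finite_dimensional_eigenspace hScpt (-1)
    (neg_ne_zero.2 one_ne_zero)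
  refine FiniteDimensional.of_injective (LinearMap.codRestrict _ _ hmap) ?_
  refine Set.injective_codRestrict _ |>.2 ?_
  exact (LinearMap.ker_eq_bot.1 hcomp.rigging.ker_eq_bot).comp (Submodule.inclusion_injective hle)

end Sandwiched

end SandwichedResolvent

theorem theoremT {E K : Type*}
    [NormedAddCommGroup E] [InnerProductSpace ℂ E] [CompleteSpace E]
    [NormedAddCommGroup K] [InnerProductSpace ℂ K] [CompleteSpace K]
    (F : E →ₗ.[ℂ] K) (𝒥 : Submodule ℝ (selfAdjoint (K →L[ℂ] K))) (H₀ : E →ₗ.[ℂ] E)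
    (hcomp : SandwichedResolvent.IsCompatible H₀ F 𝒥)
    (l : ℝ)
    (hl : ∃ H ∈ SandwichedResolvent.affineSpace H₀ F 𝒥,
      ¬ FiniteDimensional ℂ (SandwichedResolvent.eigenspace H (l : ℂ))) :
    l ∉ SandwichedResolvent.essentiallyRegularSet H₀ F 𝒥 := by
  intro hreg
  obtain ⟨H₂, h₂, hinf⟩ := hl
  obtain ⟨H₁, h₁, hl₁⟩ := Set.mem_iUnion₂.1 hreg
  exact hinf
    (SandwichedResolvent.finiteDimensional_eigenspace_of_mem_regularSet hcomp h₁ h₂ hl₁)
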